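/- A (distributive) p-algebra is an algebra $(A,\wedge,\vee,{}^*,0,1)$ such that $(A,\wedge,\vee,0,1)$ is a bounded distributive lattice and, for all $x,y\in A$, $x\wedge y=0$ if and only if $x\le y^*$ (one-element algebras are allowed). Let $\mathsf{Pa}$ be the class of all p-algebras. For $k\in\mathbb{N}=\{0,1,2,\dots\}$ let $\bar{\mathbf B}_k$ be the finite p-algebra obtained from the Boolean algebra with $k$ atoms by adding a new top element above its old top, and let $\mathsf{Pa}_k=\mathbf{HSP}(\bar{\mathbf B}_k)$ be the variety it generates; let $\mathsf{Pa}_{-1}$ be the class of one-element p-algebras. A quasivariety of p-algebras is a class of p-algebras axiomatized, within $\mathsf{Pa}$, by a set of quasi-identities $s_1=t_1\,\&\cdots\&\,s_n=t_n\Rightarrow s=t$ ($n\ge 0$). Write $\mathbf Q(\mathbf A)$ for the least quasivariety of p-algebras containing $\mathbf A$. **Lemma 2.1.** Let $m\in\{-1,0,1,2,\dots\}$ and let $\mathsf K$ be a cover of $\mathsf{Pa}_m$ in the lattice of quasivarieties of p-algebras, i.e. $\mathsf K$ is a quasivariety of p-algebras, $\mathsf{Pa}_m\subsetneq\mathsf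 K$, and there is no quasivariety $\mathsf L$ of p-algebras with $\mathsf{Pa}_m\subsetneq\mathsf L\subsetneq\mathsf K$. Then there is a finite p-algebra $\mathbf A$ with $\mathsf K=\mathbf Q(\mathbf A)$. -/

import Mathlib

universe u v

/-- A (distributive) p-algebra: a bounded distributive lattice with a unary operation `ᶜ`
(written `*` in the literature) such that `x ∧ y = 0` if and only if `x ≤ y*`.
The one-element algebra (in which `⊥ = ⊤`) is allowed. -/
class PAlgebra (α : Type u) extends DistribLattice α, BoundedOrder α, Compl α where
  inf_eq_bot_iff_le_compl : ∀ x y : α, x ⊓ y = ⊥ ↔ x ≤ yᶜ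

/-- The class of all p-algebras (with carrier in `Type u`). -/
structure PAlg : Type (u + 1) where
  carrier : Type u
  [str : PAlgebra carrier]

namespace PAlg

instance : CoeSort PAlg.{u} (Type u) := ⟨PAlg.carrier⟩

instance (A : PAlg.{u}) : PAlgebra A := A.str

/-- Homomorphisms of p-algebras: maps preserving all the basic operations. -/
structure IsHom {α : Type u} {β : Type v} [PAlgebra α] [PAlgebra β] (f : α → β) : Prop where
  map_bot : f ⊥ = ⊥
  map_top : f ⊤ = ⊤
  map_inf : ∀ x y, f (x ⊓ y) = f x ⊓ f y
  map_sup : ∀ x y, f (x ⊔ y) = f x ⊔ f y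
  map_compl : ∀ x, f xᶜ = (f x)ᶜ

/-- Direct products of p-algebras, with the pointwise operations. -/
instance instPAlgebraPi {ι : Type v} (F : ι → Type u) [∀ i, PAlgebra (F i)] :
    PAlgebra (∀ i, F i) where
  inf_eq_bot_iff_le_compl x y := by
    simp only [funext_iff, Pi.le_def, Pi.inf_apply, Pi.bot_apply, Pi.compl_apply,
      PAlgebra.inf_eq_bot_iff_le_compl]

/-! ### The class operators `H`, `S`, `P` -/

/-- The class of all homomorphic images of members of `C`. -/
def H (C : Set PAlg.{u}) : Set PAlg.{u} :=
  {A | ∃ B ∈ C, ∃ f : B → A, IsHom f ∧ Function.Surjective f}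

/-- The class of all algebras isomorphic to a subalgebra of a member of `C`. -/
def S (C : Set PAlg.{u}) : Set PAlg.{u} :=
  {A | ∃ B ∈ C, ∃ f : A → B, IsHom f ∧ Function.Injective f}

/-- The class of all algebras isomorphic to a direct product of a (possibly empty) family
of members of `C`. -/
def P (C : Set PAlg.{u}) : Set PAlg.{u} :=
  {A | ∃ (ι : Type u) (F : ι → PAlg.{u}), (∀ i, F i ∈ C) ∧
    ∃ f : A → (∀ i, F i), IsHom f ∧ Function.Bijective f}

/-! ### The algebras `B̄ₖ` and the varieties `Paₘ` -/

/-- The powerset Boolean algebra of `X` with a new top element `⊤` added above its old top.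
A new top element has pseudocomplement `⊥`, the pseudocomplement of `⊥` is the new top, and
a nonempty set has its usual complement as pseudocomplement. -/
noncomputable instance instPAlgebraWithTopSet (X : Type u) : PAlgebra (WithTop (Set X)) where
  compl := fun a => open Classical in
    match a with
    | none => ((∅ : Set X) : WithTop (Set X))
    | some s => if s = ∅ then ⊤ else ((sᶜ : Set X) : WithTop (Set X))
  inf_eq_bot_iff_le_compl := by
    have hbot : (⊥ : WithTop (Set X)) = ((∅ : Set X) : WithTop (Set X)) := rfl
    intro x y
    induction y using WithTop.recTopCoe with
    | top =>
      change x ⊓ ⊤ = ⊥ ↔ x ≤ ((∅ : Set X) : WithTop (Set X))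
      rw [inf_top_eq, ← hbot, le_bot_iff]
    | coe t =>
      change x ⊓ (t : WithTop (Set X)) = ⊥ ↔
        x ≤ open Classical in
          (if t = ∅ then ⊤ else ((tᶜ : Set X) : WithTop (Set X)))
      by_cases ht : t = ∅
      · subst ht
        rw [if_pos rfl, ← hbot]
        simp
      · rw [if_neg ht]
        induction x using WithTop.recTopCoe with
        | top =>
          rw [top_inf_eq, hbot]
          simp [ht]
        | coe s =>
          rw [← WithTop.coe_inf, hbot, WithTop.coe_eq_coe, WithTop.coe_le_coe]
          exact Set.disjoint_iff_inter_eq_empty.symm.trans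
            Set.subset_compl_iff_disjoint_right.symm

/-- `B̄ₖ`: the Boolean algebra with `k` atoms with an extra cover of the top element. -/
noncomputable def Bbar (k : ℕ) : PAlg.{u} where
  carrier := WithTop (Set (ULift.{u} (Fin k)))

/-- The varieties `Pa₋₁ ⊂ Pa₀ ⊂ Pa₁ ⊂ ⋯`. The index `⊥` stands for `-1`: `Pa ⊥` is the trivial
variety of one-element p-algebras; for `k : ℕ`, `Pa k = HSP(B̄ₖ)`. -/
noncomputable def Pa : WithBot ℕ → Set PAlg.{u}
  | none => {A | Subsingleton A}
  | some k => H (S (P {Bbar k}))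

/-! ### Quasi-identities and quasivarieties -/

/-- Terms in the language of p-algebras, in the variables `x₀, x₁, x₂, …`. -/
inductive Term : Type
  | var (n : ℕ) : Term
  | bot : Term
  | top : Term
  | inf (s t : Term) : Term
  | sup (s t : Term) : Term
  | compl (t : Term) : Term

/-- The value of a term under an assignment of the variables. -/
def Term.eval {α : Type u} [PAlgebra α] (v : ℕ → α) : Term → α
  | .var n => v n
  | .bot => ⊥
  | .top => ⊤
  | .inf s t => s.eval v ⊓ t.eval v
  | .sup s t => s.eval v ⊔ t.eval v
  | .compl t => (t.eval v)ᶜ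

/-- A quasi-identity `s₁ = t₁ ∧ ⋯ ∧ sₙ = tₙ → s = t`, with `n ≥ 0` premises. -/
structure QuasiIdentity : Type where
  premises : List (Term × Term)
  conclusion : Term × Term

/-- `A` satisfies the quasi-identity `q` (under all assignments). -/
def Satisfies (A : PAlg.{u}) (q : QuasiIdentity) : Prop :=
  ∀ v : ℕ → A, (∀ e ∈ q.premises, e.1.eval v = e.2.eval v) →
    q.conclusion.1.eval v = q.conclusion.2.eval v

/-- A quasivariety of p-algebras: a class of p-algebras axiomatized, among all p-algebras, by a
set of quasi-identities. -/
def IsQuasivariety (K : Set PAlg.{u}) : Prop :=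
  ∃ Γ : Set QuasiIdentity, K = {A | ∀ q ∈ Γ, Satisfies A q}

/-- `Q C`: the quasivariety generated by `C`, i.e. the least quasivariety containing `C`. -/
def Q (C : Set PAlg.{u}) : Set PAlg.{u} :=
  ⋂₀ {K | IsQuasivariety K ∧ C ⊆ K}

/-- `K` covers `V` in the lattice of quasivarieties of p-algebras: `K` is a quasivariety properly
containing `V`, and no quasivariety lies strictly between. -/
def IsCover (V K : Set PAlg.{u}) : Prop :=
  IsQuasivariety K ∧ V ⊂ K ∧ ∀ L : Set PAlg.{u}, IsQuasivariety L → V ⊂ L → ¬ L ⊂ K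

end PAlg

/-! For `k : ℕ`, take `B` in the cover but outside `Pa k`. Since `Pa k` is defined by an identity in
finitely many variables, a failure of it in `B` already occurs in a finitely generated subalgebra
`C`, and such a `C` is finite. The witness is `A = C × B̄ₖ`: it lies in the cover, and it is outside
`Pa k` because its image `C` is. Conversely, homomorphisms into `B̄ₖ` separate the points of any
member of `Pa k`, and pairing them with some homomorphism `B̄ₖ → C` lands in `A`, so `Pa k ⊆ Q {A}`.
The covering property then forces equality. For index `-1` the subalgebra generated by the constants
suffices.

Both inputs use prime filters: `xᶜ` belongs to a prime filter `P` exactly when no maximal filter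
above `P` contains `x` (`IsPrimeFilter.compl_mem_iff`). Lee's identity bounds the number of maximal
filters above `P`, which yields the maps to `B̄ₖ` (`mem_Pa_iff`). On a subalgebra generated by `Y`,
`P` is determined by its trace on `Y` and the traces of the maximal filters above it
(`finite_generated`). -/

namespace PAlg

/-! ### Elementary identities, homomorphisms and binary products. -/

section Basic

variable {α : Type u} {β : Type v} [PAlgebra α] [PAlgebra β]

theorem inf_compl_eq_bot (x : α) : x ⊓ xᶜ = ⊥ := by
  rw [inf_comm, PAlgebra.inf_eq_bot_iff_le_compl]

theorem bot_compl_eq_top : (⊥ : α)ᶜ = ⊤ := by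
  rw [eq_top_iff, ← PAlgebra.inf_eq_bot_iff_le_compl, inf_bot_eq]

theorem compl_eq_top_iff {x : α} : xᶜ = ⊤ ↔ x = ⊥ := by
  rw [eq_top_iff, ← PAlgebra.inf_eq_bot_iff_le_compl, top_inf_eq]

/-- Density of `d ⊔ dᶜ`: this is why a prime filter containing all dense elements decides every
element. -/
theorem inf_eq_bot_of_inf_compl_eq_bot {x d : α} (h : x ⊓ (d ⊔ dᶜ) = ⊥) : x = ⊥ := by
  rw [inf_sup_left, sup_eq_bot_iff, PAlgebra.inf_eq_bot_iff_le_compl] at h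
  rw [← h.2, inf_eq_left.2 h.1]

theorem IsHom.map_finset_sup {f : α → β} (hf : IsHom f) {ι : Type*} (s : Finset ι) (g : ι → α) :
    f (s.sup g) = s.sup fun i => f (g i) :=
  Finset.apply_sup_eq_sup_comp f hf.map_sup hf.map_bot

theorem IsHom.map_finset_inf {f : α → β} (hf : IsHom f) {ι : Type*} (s : Finset ι) (g : ι → α) :
    f (s.inf g) = s.inf fun i => f (g i) :=
  Finset.apply_inf_eq_inf_comp f hf.map_inf hf.map_top

theorem IsHom.eval {f : α → β} (hf : IsHom f) (w : ℕ → α) (t : Term) :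
    f (t.eval w) = t.eval fun n => f (w n) := by
  induction t with
  | var n => rfl
  | bot => exact hf.map_bot
  | top => exact hf.map_top
  | inf s t hs ht => simp only [Term.eval, hf.map_inf, hs, ht]
  | sup s t hs ht => simp only [Term.eval, hf.map_sup, hs, ht]
  | compl t ht => simp only [Term.eval, hf.map_compl, ht]

theorem IsHom.comp {γ : Type*} [PAlgebra γ] {g : β → γ} {f : α → β} (hg : IsHom g)
    (hf : IsHom f) : IsHom fun x => g (f x) where
  map_bot := by rw [hf.map_bot, hg.map_bot]
  map_top := by rw [hf.map_top, hg.map_top]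
  map_inf x y := by rw [hf.map_inf, hg.map_inf]
  map_sup x y := by rw [hf.map_sup, hg.map_sup]
  map_compl x := by rw [hf.map_compl, hg.map_compl]

instance instPAlgebraProd : PAlgebra (α × β) where
  compl x := (x.1ᶜ, x.2ᶜ)
  inf_eq_bot_iff_le_compl x y := by
    rw [Prod.ext_iff, Prod.le_def]
    exact and_congr (PAlgebra.inf_eq_bot_iff_le_compl _ _) (PAlgebra.inf_eq_bot_iff_le_compl _ _)

theorem isHom_fst : IsHom (Prod.fst : α × β → α) :=
  ⟨rfl, rfl, fun _ _ => rfl, fun _ _ => rfl, fun _ => rfl⟩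

theorem isHom_snd : IsHom (Prod.snd : α × β → β) :=
  ⟨rfl, rfl, fun _ _ => rfl, fun _ _ => rfl, fun _ => rfl⟩

theorem IsHom.prodMk {γ : Type*} [PAlgebra γ] {f : γ → α} {g : γ → β} (hf : IsHom f)
    (hg : IsHom g) : IsHom fun x => (f x, g x) where
  map_bot := Prod.ext hf.map_bot hg.map_bot
  map_top := Prod.ext hf.map_top hg.map_top
  map_inf x y := Prod.ext (hf.map_inf x y) (hg.map_inf x y)
  map_sup x y := Prod.ext (hf.map_sup x y) (hg.map_sup x y)
  map_compl x := Prod.ext (hf.map_compl x) (hg.map_compl x)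

theorem isHom_eval_pi {ι : Type v} (F : ι → Type u) [∀ i, PAlgebra (F i)] (i : ι) :
    IsHom (fun x : ∀ i, F i => x i) :=
  ⟨rfl, rfl, fun _ _ => rfl, fun _ _ => rfl, fun _ => rfl⟩

end Basic

/-! ### Quasi-identities and separating homomorphisms -/

/-- Replaces closure under subalgebras and products: premises push forward along `f`, so a failed
conclusion would be separated by a map into an algebra where it holds. -/
theorem Satisfies.of_separating {A : PAlg.{u}} {q : QuasiIdentity}
    (h : ∀ a b : A, a ≠ b → ∃ B : PAlg.{u}, Satisfies B q ∧ ∃ f : A → B, IsHom f ∧ f a ≠ f b) :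
    Satisfies A q := by
  intro w hw
  by_contra hne
  obtain ⟨B, hB, f, hf, hfne⟩ := h _ _ hne
  refine hfne ?_
  rw [hf.eval, hf.eval]
  refine hB _ fun e he => ?_
  rw [← hf.eval, ← hf.eval, hw e he]

theorem IsQuasivariety.mem_of_separating {K : Set PAlg.{u}} (hK : IsQuasivariety K) {A : PAlg.{u}}
    (h : ∀ a b : A, a ≠ b → ∃ B ∈ K, ∃ f : A → B, IsHom f ∧ f a ≠ f b) : A ∈ K := by
  obtain ⟨Γ, rfl⟩ := hK
  intro q hq
  refine Satisfies.of_separating fun a b hab => ?_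
  obtain ⟨B, hB, hf⟩ := h a b hab
  exact ⟨B, hB q hq, hf⟩

theorem mem_Q_self (A : PAlg.{u}) : A ∈ Q {A} := fun _ hL => hL.2 rfl

theorem Q_subset {K C : Set PAlg.{u}} (hK : IsQuasivariety K) (h : C ⊆ K) : Q C ⊆ K :=
  Set.sInter_subset_of_mem ⟨hK, h⟩

theorem isQuasivariety_Q (C : Set PAlg.{u}) : IsQuasivariety (Q C) := by
  refine ⟨{q | ∀ A ∈ C, Satisfies A q}, Set.Subset.antisymm ?_ ?_⟩
  · exact Q_subset ⟨_, rfl⟩ fun A hA q hq => hq A hA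
  · rintro A hA L ⟨⟨Γ, rfl⟩, hCL⟩ q hq
    exact hA q fun B hB => hCL hB q hq

theorem IsCover.eq_Q {V K : Set PAlg.{u}} (h : IsCover V K) {A : PAlg.{u}} (hA : A ∈ K)
    (hAV : A ∉ V) (hV : V ⊆ Q {A}) : K = Q {A} := by
  have hsub : Q {A} ⊆ K := Q_subset h.1 (Set.singleton_subset_iff.2 hA)
  by_contra hne
  exact h.2.2 _ (isQuasivariety_Q {A}) ⟨hV, fun hle => hAV (hle (mem_Q_self A))⟩
    ⟨hsub, fun hle => hne (Set.Subset.antisymm hle hsub)⟩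

/-! ### Prime and maximal filters -/

section Filters

variable {α : Type u} [PAlgebra α]

/-- Prime filters, as sets. -/
structure IsPrimeFilter (P : Set α) : Prop where
  top_mem : ⊤ ∈ P
  bot_notMem : ⊥ ∉ P
  inf_mem_iff : ∀ x y, x ⊓ y ∈ P ↔ x ∈ P ∧ y ∈ P
  sup_mem_iff : ∀ x y, x ⊔ y ∈ P ↔ x ∈ P ∨ y ∈ P

/-- Maximal proper filters, described as the prime filters that decide every element. -/
structure IsMaxFilter (M : Set α) : Prop extends IsPrimeFilter M where
  mem_or_compl_mem : ∀ x, x ∈ M ∨ xᶜ ∈ M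

theorem exists_isPrimeFilter {F : Set α} (htop : ⊤ ∈ F) (hup : ∀ x y, x ≤ y → x ∈ F → y ∈ F)
    (hinf : ∀ x ∈ F, ∀ y ∈ F, x ⊓ y ∈ F) {b : α} (hb : b ∉ F) :
    ∃ P, IsPrimeFilter P ∧ F ⊆ P ∧ b ∉ P := by
  have hF : Order.IsPFilter F := Order.IsPFilter.of_def ⟨⊤, htop⟩
    (fun x hx y hy => ⟨x ⊓ y, hinf x hx y hy, inf_le_left, inf_le_right⟩)
    (fun {x y} hxy hx => hup x y hxy hx)
  have hdisj : Disjoint (hF.toPFilter : Set α) (Order.Ideal.principal b : Set α) := by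
    rw [Set.disjoint_left]
    exact fun x hx hxb => hb (hup x b hxb hx)
  obtain ⟨J, hJ, hbJ, hFJ⟩ := DistribLattice.prime_ideal_of_disjoint_filter_ideal hdisj
  have hFJ' : ∀ x ∈ F, x ∉ J := fun x hx hxJ => Set.disjoint_left.1 hFJ hx hxJ
  refine ⟨(J : Set α)ᶜ, ⟨hFJ' _ htop, fun h => h J.bot_mem, fun x y => ?_, fun x y => ?_⟩, hFJ',
    fun h => h (hbJ (show b ∈ Order.Ideal.principal b from le_rfl))⟩
  · simp only [Set.mem_compl_iff, SetLike.mem_coe]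
    rw [← not_or, not_iff_not]
    exact ⟨fun h => hJ.mem_or_mem h,
      fun h => h.elim (fun h => J.lower inf_le_left h) fun h => J.lower inf_le_right h⟩
  · simp only [Set.mem_compl_iff, SetLike.mem_coe, Order.Ideal.sup_mem_iff, not_and_or]

namespace IsPrimeFilter

variable {P : Set α}

theorem mem_of_le (hP : IsPrimeFilter P) {x y : α} (h : x ≤ y) (hx : x ∈ P) : y ∈ P := by
  rw [← inf_eq_left.2 h, hP.inf_mem_iff] at hx
  exact hx.2

theorem notMem_of_compl_mem (hP : IsPrimeFilter P) {x : α} (h : xᶜ ∈ P) : x ∉ P := fun hx =>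
  hP.bot_notMem (inf_compl_eq_bot x ▸ (hP.inf_mem_iff x xᶜ).2 ⟨hx, h⟩)

theorem finset_inf_mem_iff (hP : IsPrimeFilter P) {ι : Type*} (s : Finset ι) (g : ι → α) :
    s.inf g ∈ P ↔ ∀ i ∈ s, g i ∈ P := by
  classical
  induction s using Finset.induction_on with
  | empty => simp [hP.top_mem]
  | insert i s _ ih => simp [hP.inf_mem_iff, ih]

theorem finset_sup_mem_iff (hP : IsPrimeFilter P) {ι : Type*} (s : Finset ι) (g : ι → α) :
    s.sup g ∈ P ↔ ∃ i ∈ s, g i ∈ P := by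
  classical
  induction s using Finset.induction_on with
  | empty => simp [hP.bot_notMem]
  | insert i s _ ih => simp [hP.sup_mem_iff, ih]

theorem exists_isMaxFilter (hP : IsPrimeFilter P) {x : α} (hx : xᶜ ∉ P) :
    ∃ M, IsMaxFilter M ∧ P ⊆ M ∧ x ∈ M := by
  -- The filter generated by `P`, `x` and all dense elements `d`. Any prime filter above it contains
  -- each `y ⊔ yᶜ`, hence is maximal.
  let F : Set α := {z | ∃ p ∈ P, ∃ d, (∀ w, w ⊓ d = ⊥ → w = ⊥) ∧ p ⊓ x ⊓ d ≤ z}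
  have hbot : ⊥ ∉ F := by
    rintro ⟨p, hp, d, hd, h⟩
    have := hd _ (le_bot_iff.1 h)
    exact hx (hP.mem_of_le ((PAlgebra.inf_eq_bot_iff_le_compl _ _).1 this) hp)
  have htop1 : ∀ w : α, w ⊓ ⊤ = ⊥ → w = ⊥ := fun w hw => by rwa [inf_top_eq] at hw
  obtain ⟨M, hM, hFM, -⟩ := exists_isPrimeFilter (F := F)
    ⟨⊤, hP.top_mem, ⊤, htop1, le_top⟩
    (fun y z hyz ⟨p, hp, d, hd, h⟩ => ⟨p, hp, d, hd, h.trans hyz⟩)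
    (by
      rintro y ⟨p, hp, d, hd, h⟩ z ⟨p', hp', d', hd', h'⟩
      refine ⟨p ⊓ p', (hP.inf_mem_iff _ _).2 ⟨hp, hp'⟩, d ⊓ d', fun w hw => ?_, le_inf ?_ ?_⟩
      · exact hd _ (hd' _ (by rwa [inf_assoc]))
      · exact le_trans (by gcongr <;> exact inf_le_left) h
      · exact le_trans (by gcongr <;> exact inf_le_right) h') hbot
  refine ⟨M, ⟨hM, fun y => ?_⟩, fun p hp => hFM ⟨p, hp, ⊤, htop1, ?_⟩,
    hFM ⟨⊤, hP.top_mem, ⊤, htop1, ?_⟩⟩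
  · rw [← hM.sup_mem_iff]
    exact hFM ⟨⊤, hP.top_mem, _, fun w hw => inf_eq_bot_of_inf_compl_eq_bot hw, inf_le_right⟩
  · exact inf_le_left.trans inf_le_left
  · exact inf_le_left.trans inf_le_right

theorem compl_mem_iff (hP : IsPrimeFilter P) (x : α) :
    xᶜ ∈ P ↔ ∀ M, IsMaxFilter M → P ⊆ M → x ∉ M := by
  refine ⟨fun h M hM hPM => hM.notMem_of_compl_mem (hPM h), fun h => ?_⟩
  by_contra hx
  obtain ⟨M, hM, hPM, hxM⟩ := hP.exists_isMaxFilter hx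
  exact h M hM hPM hxM

end IsPrimeFilter

theorem IsMaxFilter.compl_mem_iff {M : Set α} (hM : IsMaxFilter M) (x : α) : xᶜ ∈ M ↔ x ∉ M :=
  ⟨hM.notMem_of_compl_mem, fun h => (hM.mem_or_compl_mem x).resolve_left h⟩

theorem IsMaxFilter.exists_mem_notMem {M N : Set α} (hM : IsMaxFilter M) (hN : IsMaxFilter N)
    (h : M ≠ N) : ∃ x, x ∈ M ∧ x ∉ N := by
  by_contra! hle
  refine h (Set.Subset.antisymm hle fun x hx => ?_)
  by_contra hxM
  exact hN.notMem_of_compl_mem (hle _ ((hM.compl_mem_iff x).2 hxM)) hx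

theorem exists_isPrimeFilter_of_not_le {a b : α} (h : ¬ a ≤ b) :
    ∃ P, IsPrimeFilter P ∧ a ∈ P ∧ b ∉ P := by
  obtain ⟨P, hP, hF, hb⟩ := exists_isPrimeFilter (F := Set.Ici a) (Set.mem_Ici.2 le_top)
    (fun x y hxy hx => le_trans hx hxy) (fun x hx y hy => le_inf hx hy) h
  exact ⟨P, hP, hF le_rfl, hb⟩

theorem eq_of_forall_isPrimeFilter {a b : α} (h : ∀ P, IsPrimeFilter P → (a ∈ P ↔ b ∈ P)) :
    a = b := by
  refine le_antisymm ?_ ?_ <;> by_contra hle <;>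
    obtain ⟨P, hP, h1, h2⟩ := exists_isPrimeFilter_of_not_le hle
  · exact h2 ((h P hP).1 h1)
  · exact h2 ((h P hP).2 h1)

open Classical in
-- The characteristic map of `M`; using only `⊥` and `⊤` as values, it works for every target.
theorem IsMaxFilter.isHom_ite {M : Set α} (hM : IsMaxFilter M) (β : Type v) [PAlgebra β] :
    IsHom fun x : α => if x ∈ M then (⊤ : β) else ⊥ where
  map_bot := if_neg hM.bot_notMem
  map_top := if_pos hM.top_mem
  map_inf x y := by
    by_cases hx : x ∈ M <;> by_cases hy : y ∈ M <;> simp [hM.inf_mem_iff, hx, hy]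
  map_sup x y := by
    by_cases hx : x ∈ M <;> by_cases hy : y ∈ M <;> simp [hM.sup_mem_iff, hx, hy]
  map_compl x := by
    by_cases hx : x ∈ M
    · have : (⊤ : β)ᶜ = ⊥ := by simpa using inf_compl_eq_bot (⊤ : β)
      simp [hM.compl_mem_iff, hx, this]
    · simp [hM.compl_mem_iff, hx, bot_compl_eq_top]

theorem exists_isHom [Nontrivial α] (β : Type v) [PAlgebra β] : ∃ f : α → β, IsHom f := by
  have h : ¬ (⊤ : α) ≤ ⊥ := fun h => bot_ne_top (le_bot_iff.1 h).symm
  obtain ⟨P, hP, -⟩ := exists_isPrimeFilter_of_not_le h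
  have hx : (⊤ : α)ᶜ ∉ P := fun h => hP.notMem_of_compl_mem h hP.top_mem
  obtain ⟨M, hM, -⟩ := hP.exists_isMaxFilter hx
  exact ⟨_, hM.isHom_ite β⟩

/-! ### Homomorphisms into Boolean algebras with a new top -/

theorem withTop_compl_top {X : Type u} : (⊤ : WithTop (Set X))ᶜ = ((∅ : Set X) : WithTop (Set X)) :=
  rfl

theorem withTop_compl_coe {X : Type u} {s : Set X} (hs : s ≠ ∅) :
    (s : WithTop (Set X))ᶜ = ((sᶜ : Set X) : WithTop (Set X)) :=
  if_neg hs

open Classical in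
-- The family may repeat or omit maximal filters. `hcover` is needed only for complements: `∅` has
-- complement `⊤`, not the full set, so `x` may be sent to `∅` only when `xᶜ ∈ P`.
theorem IsPrimeFilter.isHom_withTop {P : Set α} (hP : IsPrimeFilter P) {X : Type v}
    {M : X → Set α} (hM : ∀ i, IsMaxFilter (M i)) (hPM : ∀ i, P ⊆ M i)
    (hcover : ∀ x, x ∉ P → xᶜ ∉ P → ∃ i, x ∈ M i) :
    IsHom fun x : α => if x ∈ P then (⊤ : WithTop (Set X)) else (({i | x ∈ M i} : Set X)) where
  map_bot := by
    rw [if_neg hP.bot_notMem]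
    refine congrArg WithTop.some (Set.eq_empty_of_forall_notMem fun i hi => (hM i).bot_notMem hi)
  map_top := if_pos hP.top_mem
  map_inf x y := by
    by_cases hx : x ∈ P <;> by_cases hy : y ∈ P
    · simp [hP.inf_mem_iff, hx, hy]
    · have : ∀ i, x ∈ M i := fun i => hPM i hx
      simp [hP.inf_mem_iff, hx, hy, (hM _).inf_mem_iff, this]
    · have : ∀ i, y ∈ M i := fun i => hPM i hy
      simp [hP.inf_mem_iff, hx, hy, (hM _).inf_mem_iff, this]
    · simp only [hP.inf_mem_iff, hx, hy, (hM _).inf_mem_iff, false_and, if_false]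
      rfl
  map_sup x y := by
    by_cases hx : x ∈ P
    · simp [hP.sup_mem_iff, hx]
    by_cases hy : y ∈ P
    · simp [hP.sup_mem_iff, hy]
    simp only [hP.sup_mem_iff, hx, hy, (hM _).sup_mem_iff, false_or, if_false]
    rfl
  map_compl x := by
    by_cases hx : x ∈ P
    · have hxc : xᶜ ∉ P := fun h => hP.notMem_of_compl_mem h hx
      rw [if_pos hx, if_neg hxc, withTop_compl_top]
      refine congrArg WithTop.some (Set.eq_empty_of_forall_notMem fun i hi => ?_)
      exact (hM i).notMem_of_compl_mem hi (hPM i hx)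
    · rw [if_neg hx]
      by_cases hxc : xᶜ ∈ P
      · have : {i | x ∈ M i} = ∅ := Set.eq_empty_of_forall_notMem fun i hi =>
          (hM i).notMem_of_compl_mem (hPM i hxc) hi
        rw [if_pos hxc, this]
        exact bot_compl_eq_top.symm
      · obtain ⟨i, hi⟩ := hcover x hx hxc
        rw [if_neg hxc, withTop_compl_coe (Set.nonempty_iff_ne_empty.1 ⟨i, hi⟩)]
        refine congrArg WithTop.some (Set.ext fun j => (hM j).compl_mem_iff x)

end Filters

/-! ### Equational characterisation of the varieties `Pa k` -/

/-- A variant of Lee's identity axiomatizing `Pa k`. -/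
def Lee (α : Type u) [PAlgebra α] : ℕ → Prop
  | 0 => ∀ x : α, x ⊔ xᶜ = ⊤
  | k + 1 => ∀ y : Fin (k + 2) → α, (Finset.univ.sup fun i =>
      (y i ⊓ (Finset.univ.erase i).inf fun j => (y j)ᶜ)ᶜ) = ⊤

theorem IsHom.map_lee {α : Type u} {β : Type v} [PAlgebra α] [PAlgebra β] {f : α → β}
    (hf : IsHom f) {k : ℕ} (y : Fin (k + 2) → α) :
    f (Finset.univ.sup fun i => (y i ⊓ (Finset.univ.erase i).inf fun j => (y j)ᶜ)ᶜ) =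
      Finset.univ.sup fun i =>
        (f (y i) ⊓ (Finset.univ.erase i).inf fun j => (f (y j))ᶜ)ᶜ := by
  simp only [hf.map_finset_sup, hf.map_compl, hf.map_inf, hf.map_finset_inf]

theorem Lee.of_surjective {α : Type u} {β : Type v} [PAlgebra α] [PAlgebra β] {k : ℕ}
    (h : Lee α k) {f : α → β} (hf : IsHom f) (hs : Function.Surjective f) : Lee β k := by
  cases k with
  | zero =>
    intro y
    obtain ⟨x, rfl⟩ := hs y
    rw [← hf.map_compl, ← hf.map_sup, h, hf.map_top]
  | succ k =>
    intro y
    obtain ⟨x, rfl⟩ : ∃ x : Fin (k + 2) → α, (fun i => f (x i)) = y :=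
      ⟨fun i => (hs (y i)).choose, funext fun i => (hs (y i)).choose_spec⟩
    rw [← hf.map_lee, h, hf.map_top]

theorem Lee.of_separating {α : Type u} [PAlgebra α] {k : ℕ}
    (h : ∀ a b : α, a ≠ b → ∃ B : PAlg.{v}, Lee B k ∧ ∃ f : α → B, IsHom f ∧ f a ≠ f b) :
    Lee α k := by
  cases k with
  | zero =>
    intro x
    by_contra hne
    obtain ⟨B, hB, f, hf, hfne⟩ := h _ _ hne
    exact hfne (by rw [hf.map_sup, hf.map_compl, hB, hf.map_top])
  | succ k =>
    intro y
    by_contra hne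
    obtain ⟨B, hB, f, hf, hfne⟩ := h _ _ hne
    exact hfne (by rw [hf.map_lee, hB, hf.map_top])

theorem withTop_sup_eq_top {X : Type u} {ι : Type*} (s : Finset ι) (g : ι → WithTop (Set X)) :
    s.sup g = ⊤ ↔ ∃ i ∈ s, g i = ⊤ := by
  classical
  induction s using Finset.induction_on with
  | empty =>
    simp only [Finset.sup_empty, Finset.notMem_empty, false_and, exists_false, iff_false]
    exact WithTop.coe_ne_top
  | insert i s _ ih =>
    have hsup : ∀ a b : WithTop (Set X), a ⊔ b = ⊤ ↔ a = ⊤ ∨ b = ⊤ := by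
      intro a b
      induction a using WithTop.recTopCoe with
      | top => simp
      | coe a =>
        induction b using WithTop.recTopCoe with
        | top => simp
        | coe b => simp [← WithTop.coe_sup]
    simp [Finset.sup_insert, hsup, ih]

/-- For positive `k`, the new top is join-prime, so a failure gives `k + 1` nonzero, pairwise
disjoint elements, too many for `k` atoms. For `k = 0` the algebra has two elements. -/
theorem lee_Bbar (k : ℕ) : Lee (Bbar.{u} k) k := by
  cases k with
  | zero =>
    intro x
    change WithTop (Set (ULift.{u} (Fin 0))) at x
    change x ⊔ xᶜ = ⊤
    induction x using WithTop.recTopCoe with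
    | top => exact top_sup_eq _
    | coe s =>
      have hs : (s : WithTop (Set (ULift.{u} (Fin 0)))) = ⊥ :=
        congrArg WithTop.some (Subsingleton.elim s ∅)
      rw [hs, bot_compl_eq_top, sup_top_eq]
  | succ k =>
    intro y
    change Fin (k + 2) → WithTop (Set (ULift.{u} (Fin (k + 1)))) at y
    change (Finset.univ.sup fun i =>
      (y i ⊓ (Finset.univ.erase i).inf fun j => (y j)ᶜ)ᶜ) = ⊤
    rw [withTop_sup_eq_top]
    by_contra! hne
    set w : Fin (k + 2) → WithTop (Set (ULift.{u} (Fin (k + 1)))) :=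
      fun i => y i ⊓ (Finset.univ.erase i).inf fun j => (y j)ᶜ with hw
    have hbot : ∀ i, w i ≠ ⊥ := fun i h => hne i (Finset.mem_univ i) (compl_eq_top_iff.2 h)
    have hdisj : ∀ i j, i ≠ j → w i ⊓ w j = ⊥ := by
      intro i j hij
      have h1 : w i ≤ (y j)ᶜ := inf_le_right.trans
        (Finset.inf_le (Finset.mem_erase.2 ⟨hij.symm, Finset.mem_univ j⟩))
      have h2 : w j ≤ y j := inf_le_left
      rw [← le_bot_iff, ← inf_compl_eq_bot (y j), inf_comm (y j)]
      exact inf_le_inf h1 h2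
    have hcoe : ∀ i, ∃ s : Set (ULift.{u} (Fin (k + 1))), s.Nonempty ∧ w i = s := by
      intro i
      have htop : w i ≠ ⊤ := by
        intro h
        obtain ⟨j, hj⟩ := exists_ne i
        have := hdisj i j hj.symm
        rw [h, top_inf_eq] at this
        exact hbot j this
      obtain ⟨s, hs⟩ := WithTop.ne_top_iff_exists.1 htop
      refine ⟨s, Set.nonempty_iff_ne_empty.2 fun h => hbot i ?_, hs.symm⟩
      rw [← hs, h]
      rfl
    choose s hsne hs using hcoe
    choose p hp using hsne
    have hinj : Function.Injective p := by
      intro i j hij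
      by_contra hne
      have := hdisj i j hne
      rw [hs, hs, ← WithTop.coe_inf] at this
      have hemp : s i ⊓ s j = ∅ := WithTop.coe_injective this
      have hmem : p i ∈ s i ⊓ s j := ⟨hp i, hij ▸ hp j⟩
      rw [hemp] at hmem
      exact hmem
    have hcard := Fintype.card_le_of_injective p hinj
    simp at hcard

theorem exists_surjective_of_forall_not_injective {X : Type*} [Nonempty X] {n : ℕ}
    (h : ∀ f : Fin (n + 1) → X, ¬ Function.Injective f) :
    ∃ g : Fin n → X, Function.Surjective g := by
  have : Finite X := by
    by_contra hinf
    rw [not_finite_iff_infinite] at hinf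
    exact h _ ((Infinite.natEmbedding X).injective.comp Fin.val_injective)
  have := Fintype.ofFinite X
  have hcard : Fintype.card X ≤ n := by
    by_contra hlt
    obtain ⟨e⟩ : Nonempty (Fin (n + 1) ↪ X) :=
      Function.Embedding.nonempty_of_card_le (by rw [Fintype.card_fin]; omega)
    exact h e e.injective
  obtain ⟨e⟩ : Nonempty (X ↪ Fin n) :=
    Function.Embedding.nonempty_of_card_le (by rwa [Fintype.card_fin])
  exact ⟨Function.invFun e, Function.invFun_surjective e.injective⟩

/-- Given distinct maximal filters above `P`, meets of separating elements give `yᵢ` lying in the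
`i`-th filter only. The identity puts some joinand in `P`, hence in the `i`-th filter, which also
contains the element it complements. -/
theorem Lee.not_injective {α : Type u} [PAlgebra α] {k : ℕ} (h : Lee α (k + 1)) {P : Set α}
    (hP : IsPrimeFilter P) (M : Fin (k + 2) → {M : Set α // IsMaxFilter M ∧ P ⊆ M}) :
    ¬ Function.Injective M := by
  intro hinj
  have hsep : ∀ i j, ∃ z, z ∈ (M i).1 ∧ (i ≠ j → z ∉ (M j).1) := by
    intro i j
    by_cases hij : i = j
    · exact ⟨⊤, (M i).2.1.top_mem, fun h => absurd hij h⟩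
    · obtain ⟨z, hz, hz'⟩ := (M i).2.1.exists_mem_notMem (M j).2.1
        fun h => hij (hinj (Subtype.ext h))
      exact ⟨z, hz, fun _ => hz'⟩
  choose z hz hz' using hsep
  have hmem := hP.top_mem
  rw [← h fun i => Finset.univ.inf (z i), hP.finset_sup_mem_iff] at hmem
  obtain ⟨i, -, hi⟩ := hmem
  refine (M i).2.1.notMem_of_compl_mem ((M i).2.2 hi) ?_
  rw [(M i).2.1.inf_mem_iff, (M i).2.1.finset_inf_mem_iff, (M i).2.1.finset_inf_mem_iff]
  refine ⟨fun j _ => hz i j, fun j hj => ?_⟩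
  rw [(M i).2.1.compl_mem_iff, (M i).2.1.finset_inf_mem_iff]
  exact fun hall => hz' j i (Finset.ne_of_mem_erase hj) (hall i (Finset.mem_univ i))

theorem Lee.exists_isHom_of_not_le {α : Type u} [PAlgebra α] {k : ℕ} (h : Lee α k) {a b : α}
    (hab : ¬ a ≤ b) : ∃ f : α → Bbar.{v} k, IsHom f ∧ f a ≠ f b := by
  classical
  obtain ⟨P, hP, ha, hb⟩ := exists_isPrimeFilter_of_not_le hab
  obtain ⟨M, hM, hPM, hcover⟩ : ∃ M : ULift.{v} (Fin k) → Set α, (∀ i, IsMaxFilter (M i)) ∧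
      (∀ i, P ⊆ M i) ∧ ∀ x, x ∉ P → xᶜ ∉ P → ∃ i, x ∈ M i := by
    cases k with
    | zero =>
      refine ⟨fun _ => P, fun i => i.down.elim0, fun i => i.down.elim0, fun x hx hxc => ?_⟩
      have htop := hP.top_mem
      rw [← h x, hP.sup_mem_iff] at htop
      exact absurd htop (not_or.2 ⟨hx, hxc⟩)
    | succ k =>
      have : Nonempty {M : Set α // IsMaxFilter M ∧ P ⊆ M} := by
        obtain ⟨M, hM, hPM, -⟩ := hP.exists_isMaxFilter (x := ⊤)
          fun h => hP.notMem_of_compl_mem h hP.top_mem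
        exact ⟨⟨M, hM, hPM⟩⟩
      obtain ⟨g, hg⟩ := exists_surjective_of_forall_not_injective (h.not_injective hP)
      refine ⟨fun i => (g i.down).1, fun i => (g i.down).2.1, fun i => (g i.down).2.2,
        fun x _ hxc => ?_⟩
      obtain ⟨M, hM, hPM, hxM⟩ := hP.exists_isMaxFilter hxc
      obtain ⟨i, hi⟩ := hg ⟨M, hM, hPM⟩
      exact ⟨⟨i⟩, by simpa only [hi] using hxM⟩
  refine ⟨_, hP.isHom_withTop hM hPM hcover, ?_⟩
  simp only [if_pos ha, if_neg hb]
  exact WithTop.top_ne_coe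

theorem Lee.exists_isHom {α : Type u} [PAlgebra α] {k : ℕ} (h : Lee α k) {a b : α}
    (hab : a ≠ b) : ∃ f : α → Bbar.{v} k, IsHom f ∧ f a ≠ f b := by
  by_cases hle : a ≤ b
  · obtain ⟨f, hf, hne⟩ := h.exists_isHom_of_not_le fun hba => hab (le_antisymm hle hba)
    exact ⟨f, hf, hne.symm⟩
  · exact h.exists_isHom_of_not_le hle

theorem mem_Pa_iff {k : ℕ} {A : PAlg.{u}} : A ∈ Pa k ↔ Lee A k := by
  constructor
  · rintro ⟨B, ⟨C, ⟨ι, F, hF, g, hg, hgb⟩, f, hf, hfi⟩, e, he, hes⟩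
    have hC : Lee C k := Lee.of_separating fun a b hab => by
      obtain ⟨i, hi⟩ := Function.ne_iff.1 (hgb.injective.ne hab)
      refine ⟨F i, ?_, _, (isHom_eval_pi (fun i => F i) i).comp hg, hi⟩
      rw [Set.mem_singleton_iff.1 (hF i)]
      exact lee_Bbar k
    have hB : Lee B k := Lee.of_separating fun a b hab => ⟨C, hC, f, hf, hfi.ne hab⟩
    exact hB.of_surjective he hes
  · intro h
    -- One separating map per pair of distinct points embeds `A` in a power of `B̄ₖ`; no proper
    -- quotient is needed.
    choose f hf hne using fun p : {p : A × A // p.1 ≠ p.2} => h.exists_isHom.{u, u} p.2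
    refine ⟨A, ⟨⟨{p : A × A // p.1 ≠ p.2} → Bbar.{u} k⟩,
      ⟨{p : A × A // p.1 ≠ p.2}, fun _ => Bbar k, fun _ => rfl, id,
        ⟨rfl, rfl, fun _ _ => rfl, fun _ _ => rfl, fun _ => rfl⟩, Function.bijective_id⟩,
      fun x p => f p x, ⟨?_, ?_, ?_, ?_, ?_⟩, fun a b hab => ?_⟩, id,
      ⟨rfl, rfl, fun _ _ => rfl, fun _ _ => rfl, fun _ => rfl⟩, Function.surjective_id⟩
    · exact funext fun p => (hf p).map_bot
    · exact funext fun p => (hf p).map_top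
    · exact fun x y => funext fun p => (hf p).map_inf x y
    · exact fun x y => funext fun p => (hf p).map_sup x y
    · exact fun x => funext fun p => (hf p).map_compl x
    · by_contra hne'
      exact hne ⟨(a, b), hne'⟩ (congrFun hab _)

/-! ### Local finiteness -/

section Generated

variable {α : Type u} [PAlgebra α]

/-- Membership in the subalgebra generated by a set. -/
inductive Generated (Y : Set α) : α → Prop
  | basic {x : α} (hx : x ∈ Y) : Generated Y x
  | bot : Generated Y ⊥
  | top : Generated Y ⊤
  | inf {x y : α} (hx : Generated Y x) (hy : Generated Y y) : Generated Y (x ⊓ y)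
  | sup {x y : α} (hx : Generated Y x) (hy : Generated Y y) : Generated Y (x ⊔ y)
  | compl {x : α} (hx : Generated Y x) : Generated Y xᶜ

instance instPAlgebraGenerated (Y : Set α) : PAlgebra {x // Generated Y x} where
  __ := Subtype.lattice (P := Generated Y) (fun _ _ hx hy => .sup hx hy)
    fun _ _ hx hy => .inf hx hy
  le_sup_inf x y z := show (x.1 ⊔ y.1) ⊓ (x.1 ⊔ z.1) ≤ x.1 ⊔ y.1 ⊓ z.1 from le_sup_inf
  top := ⟨⊤, .top⟩
  bot := ⟨⊥, .bot⟩
  le_top x := show x.1 ≤ ⊤ from le_top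
  bot_le x := show ⊥ ≤ x.1 from bot_le
  compl x := ⟨x.1ᶜ, .compl x.2⟩
  inf_eq_bot_iff_le_compl x y :=
    Subtype.ext_iff.trans (PAlgebra.inf_eq_bot_iff_le_compl x.1 y.1)

theorem isHom_generated_val (Y : Set α) : IsHom (Subtype.val : {x // Generated Y x} → α) :=
  ⟨rfl, rfl, fun _ _ => rfl, fun _ _ => rfl, fun _ => rfl⟩

variable {Y : Set α}

theorem Generated.mem_isMaxFilter_iff {x : α} (hx : Generated Y x) {M N : Set α}
    (hM : IsMaxFilter M) (hN : IsMaxFilter N) (h : M ∩ Y = N ∩ Y) : x ∈ M ↔ x ∈ N := by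
  induction hx with
  | basic hx =>
    have := Set.ext_iff.1 h
    exact ⟨fun hxM => ((this _).1 ⟨hxM, hx⟩).1, fun hxN => ((this _).2 ⟨hxN, hx⟩).1⟩
  | bot => exact iff_of_false hM.bot_notMem hN.bot_notMem
  | top => exact iff_of_true hM.top_mem hN.top_mem
  | inf _ _ ihx ihy => rw [hM.inf_mem_iff, hN.inf_mem_iff, ihx, ihy]
  | sup _ _ ihx ihy => rw [hM.sup_mem_iff, hN.sup_mem_iff, ihx, ihy]
  | compl _ ih => rw [hM.compl_mem_iff, hN.compl_mem_iff, ih]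

/-- The traces on `Y` of the maximal filters above `P`. -/
def maxTraces (Y P : Set α) : Set (Set α) :=
  {T | ∃ M, IsMaxFilter M ∧ P ⊆ M ∧ M ∩ Y = T}

theorem Generated.compl_mem_of_maxTraces_subset {x : α} (hx : Generated Y x) {P R : Set α}
    (hR : IsPrimeFilter R) (h : maxTraces Y R ⊆ maxTraces Y P)
    (hxP : xᶜ ∈ P) : xᶜ ∈ R := by
  rw [hR.compl_mem_iff]
  intro N hN hRN hxN
  obtain ⟨M, hM, hPM, hMN⟩ := h ⟨N, hN, hRN, rfl⟩
  exact hM.notMem_of_compl_mem (hPM hxP) ((hx.mem_isMaxFilter_iff hM hN hMN).2 hxN)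

/-- Complements need no induction hypothesis: they are governed by the maximal filters above, whose
traces agree. -/
theorem Generated.mem_isPrimeFilter_iff {x : α} (hx : Generated Y x) {P R : Set α}
    (hP : IsPrimeFilter P) (hR : IsPrimeFilter R) (h : P ∩ Y = R ∩ Y)
    (hmax : maxTraces Y P = maxTraces Y R) : x ∈ P ↔ x ∈ R := by
  induction hx with
  | basic hx =>
    have := Set.ext_iff.1 h
    exact ⟨fun hxM => ((this _).1 ⟨hxM, hx⟩).1, fun hxN => ((this _).2 ⟨hxN, hx⟩).1⟩
  | bot => exact iff_of_false hP.bot_notMem hR.bot_notMem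
  | top => exact iff_of_true hP.top_mem hR.top_mem
  | inf _ _ ihx ihy => rw [hP.inf_mem_iff, hR.inf_mem_iff, ihx, ihy]
  | sup _ _ ihx ihy => rw [hP.sup_mem_iff, hR.sup_mem_iff, ihx, ihy]
  | compl hx _ => exact ⟨hx.compl_mem_of_maxTraces_subset hR hmax.ge,
      hx.compl_mem_of_maxTraces_subset hP hmax.le⟩

/-- Finitely generated p-algebras are finite. -/
theorem finite_generated (hY : Y.Finite) : Finite {x // Generated Y x} := by
  let U : Set (Set α × Set (Set α)) := 𝒫 Y ×ˢ 𝒫 (𝒫 Y)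
  have hU : U.Finite := hY.finite_subsets.prod hY.finite_subsets.finite_subsets
  have hpat : ∀ P : Set α, (P ∩ Y, maxTraces Y P) ∈ U := by
    refine fun P => ⟨Set.inter_subset_right, ?_⟩
    rintro T ⟨M, -, -, rfl⟩
    exact Set.inter_subset_right
  -- Each prime filter has one of finitely many patterns, and its pattern decides which generated
  -- elements it contains. The patterns of the prime filters through a generated `x` therefore
  -- determine `x`.
  let code (x : α) : Set (Set α × Set (Set α)) :=
    {u | ∃ P, IsPrimeFilter P ∧ x ∈ P ∧ (P ∩ Y, maxTraces Y P) = u}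
  have hcode : ∀ x, code x ∈ 𝒫 U := by
    rintro x u ⟨P, -, -, rfl⟩
    exact hpat P
  have : Finite (𝒫 U) := hU.finite_subsets
  refine Finite.of_injective
    (fun x : {x // Generated Y x} => (⟨code x.1, hcode x.1⟩ : 𝒫 U)) fun x y hxy => ?_
  have hxy' : code x.1 = code y.1 := congrArg Subtype.val hxy
  have key : ∀ x y : {x // Generated Y x}, code x.1 = code y.1 →
      ∀ P, IsPrimeFilter P → x.1 ∈ P → y.1 ∈ P := by
    intro x y h P hP hx
    have hmem : (P ∩ Y, maxTraces Y P) ∈ code y.1 := h ▸ ⟨P, hP, hx, rfl⟩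
    obtain ⟨R, hR, hyR, heq⟩ := hmem
    exact (y.2.mem_isPrimeFilter_iff hR hP (congrArg Prod.fst heq) (congrArg Prod.snd heq)).1 hyR
  exact Subtype.ext (eq_of_forall_isPrimeFilter fun P hP =>
    ⟨key x y hxy' P hP, key y x hxy'.symm P hP⟩)

theorem exists_finite_not_lee {k : ℕ} (h : ¬ Lee α k) :
    ∃ Y : Set α, Y.Finite ∧ ¬ Lee {x // Generated Y x} k := by
  cases k with
  | zero =>
    obtain ⟨x, hx⟩ := not_forall.1 h
    refine ⟨{x}, Set.finite_singleton x, fun hL => hx ?_⟩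
    exact congrArg Subtype.val (hL ⟨x, .basic rfl⟩)
  | succ k =>
    obtain ⟨y, hy⟩ := not_forall.1 h
    refine ⟨Set.range y, Set.finite_range y, fun hL => hy ?_⟩
    have := congrArg Subtype.val (hL fun i => ⟨y i, .basic ⟨i, rfl⟩⟩)
    rwa [(isHom_generated_val _).map_lee] at this

end Generated

/-! ### Finite generators of covers. -/

theorem IsQuasivariety.generated_mem {K : Set PAlg.{u}} (hK : IsQuasivariety K) {B : PAlg.{u}}
    (hB : B ∈ K) (Y : Set B) : (⟨{x // Generated Y x}⟩ : PAlg.{u}) ∈ K :=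
  hK.mem_of_separating fun _ _ hab =>
    ⟨B, hB, _, isHom_generated_val Y, Subtype.val_injective.ne hab⟩

theorem IsQuasivariety.prod_mem {K : Set PAlg.{u}} (hK : IsQuasivariety K) {A B : PAlg.{u}}
    (hA : A ∈ K) (hB : B ∈ K) : (⟨A × B⟩ : PAlg.{u}) ∈ K :=
  hK.mem_of_separating fun a b hab => by
    by_cases h : a.1 = b.1
    · exact ⟨B, hB, _, isHom_snd, fun h' => hab (Prod.ext h h')⟩
    · exact ⟨A, hA, _, isHom_fst, h⟩

instance finite_Bbar (k : ℕ) : Finite (Bbar.{u} k) :=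
  inferInstanceAs (Finite (Option (Set (ULift.{u} (Fin k)))))

instance nontrivial_Bbar (k : ℕ) : Nontrivial (Bbar.{u} k) :=
  inferInstanceAs (Nontrivial (Option (Set (ULift.{u} (Fin k)))))

theorem IsCover.exists_finite_of_bot {K : Set PAlg.{u}} (hK : IsCover (Pa ⊥) K) :
    ∃ A : PAlg.{u}, Finite A ∧ K = Q {A} := by
  obtain ⟨B, hB, hBV⟩ := Set.exists_of_ssubset hK.2.1
  -- If the subalgebra of constants were trivial, then `⊥ = ⊤` in `B`, making `B` trivial.
  refine ⟨⟨{x : B // Generated ∅ x}⟩, finite_generated Set.finite_empty,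
    hK.eq_Q (hK.1.generated_mem hB ∅) (fun hsub => hBV ?_) fun A hA => ?_⟩
  · have hsub' : Subsingleton {x : B // Generated ∅ x} := hsub
    have hbt : (⊥ : B) = ⊤ :=
      congrArg Subtype.val (Subsingleton.elim (⟨⊥, .bot⟩ : {x : B // Generated ∅ x}) ⟨⊤, .top⟩)
    exact subsingleton_of_bot_eq_top hbt
  · have hA' : Subsingleton A := hA
    exact (isQuasivariety_Q _).mem_of_separating fun a b hab => absurd (Subsingleton.elim a b) hab

theorem IsCover.exists_finite_of_natCast {k : ℕ} {K : Set PAlg.{u}} (hK : IsCover (Pa k) K) :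
    ∃ A : PAlg.{u}, Finite A ∧ K = Q {A} := by
  obtain ⟨B, hB, hBV⟩ := Set.exists_of_ssubset hK.2.1
  rw [mem_Pa_iff] at hBV
  obtain ⟨Y, hY, hL⟩ := exists_finite_not_lee hBV
  have := finite_generated hY
  -- The first factor keeps the product out of `Pa k`; the second puts `Pa k` inside the
  -- quasivariety it generates.
  refine ⟨⟨{x // Generated Y x} × Bbar.{u} k⟩,
    inferInstanceAs (Finite ({x // Generated Y x} × Bbar.{u} k)), hK.eq_Q ?_ ?_ ?_⟩
  · exact hK.1.prod_mem (hK.1.generated_mem hB Y) (hK.2.1.1 (mem_Pa_iff.2 (lee_Bbar k)))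
  · intro hA
    exact hL ((mem_Pa_iff.1 hA).of_surjective isHom_fst Prod.fst_surjective)
  · intro A hA
    refine (isQuasivariety_Q _).mem_of_separating fun a b hab => ⟨_, mem_Q_self _, ?_⟩
    obtain ⟨f, hf, hne⟩ := (mem_Pa_iff.1 hA).exists_isHom.{u, u} hab
    -- `g` merely fills the first coordinate; the separation comes from `f` in the second.
    obtain ⟨g, hg⟩ := exists_isHom (α := Bbar.{u} k) {x // Generated Y x}
    exact ⟨_, (hg.comp hf).prodMk hf, fun h => hne (congrArg Prod.snd h)⟩

end PAlg

theorem lemma2p1 (m : WithBot ℕ) (K : Set PAlg.{u}) (hK : PAlg.IsCover (PAlg.Pa m) K) :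
    ∃ A : PAlg.{u}, Finite A ∧ K = PAlg.Q {A} := by
  induction m using WithBot.recBotCoe with
  | bot => exact hK.exists_finite_of_bot
  | coe k => exact hK.exists_finite_of_natCast
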